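/- Let $k$ be a field and let $n \ge 2$. Order $\mathbb{R}^n$ coordinatewise. An $\mathbb{R}^n$-module is a functor from the poset $\mathbb{R}^n$ to the category of $k$-vector spaces (of arbitrary dimension); write $M_p$ for the value of $M$ at $p$, and $\phi_M(p,q) : M_p \to M_q$ ($p \le q$) for its internal maps. For $\epsilon \ge 0$ write $p+\epsilon = p + (\epsilon,\dots,\epsilon)$, and let $M(\epsilon)$ be the shifted module $M(\epsilon)_p = M_{p+\epsilon}$. An interval is a nonempty order-convex subset $I \subseteq \mathbb{R}^n$ in which any two points are joined by a finite zigzag of comparable points of $I$; its interval module $\mathbb{I}^I$ is $k$ at the points of $I$ and $0$ elsewhere, with identity maps between the points of $I$. If $M \cong \bigoplus_{I \in B} \mathbb{I}^I$ for a multiset $B$ of intervals, $M$ is called interval decomposable and $B = B(M)$ is its barcode (which is unique). A module is free if it is interval decomposable and every interval in its barcode has the form $\{q : q \ge p\}$ with $p \in \mathbb{R}^n$. Modules $M$ and $N$ are $\epsilon$-interleaved if there are morphisms $f : M \to N(\epsilon)$ and $g : N \to M(\epsilon)$ with $g_{p+\epsilon} \circ f_p = \phi_M(p,p+2\epsilon)$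 and $f_{p+\epsilon} \circ g_p = \phi_N(p,p+2\epsilon)$ for all $p$. Interval decomposable modules $M$ and $N$ are $\epsilon$-matched if there is a bijection $\sigma$ from a sub-multiset of $B(M)$ onto a sub-multiset of $B(N)$ such that $\mathbb{I}^I$ and $\mathbb{I}^{\sigma(I)}$ are $\epsilon$-interleaved for every $I$ in the domain of $\sigma$, and such that for every $I$ in $B(M)$ or $B(N)$ not matched by $\sigma$ all the maps $\phi_{\mathbb{I}^I}(p,p+2\epsilon)$ are $0$. Put $$d_I(M,N) = \inf\{\epsilon \ge 0 : M, N \text{ are } \epsilon\text{-interleaved}\}, \qquad d_B(M,N) = \inf\{\epsilon \ge 0 : M, N \text{ are } \epsilon\text{-matched}\}$$ in $[0,\infty]$, with $\inf \varnothing = \infty$. Then for all free $\mathbb{R}^n$-modules $M$ and $N$ (not necessarily pointwise finite-dimensional), $$d_B(M,N) \le (n-1)\, d_I(M,N).$$ -/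

import Mathlib

open CategoryTheory
open scoped NNReal ENNReal DirectSum

universe u v

noncomputable section

namespace Persistence

/-- A persistence module over the poset `P`: a functor from `P`, seen as a category, to the
category of vector spaces over `k`. No finiteness is assumed. -/
abbrev PModule (k : Type u) [Field k] (P : Type v) [Preorder P] := P ⥤ ModuleCat.{u} k

/-- An interval in a poset: a nonempty, order-convex subset in which any two points are joined
by a finite zigzag of comparable points of the subset. (A chain of comparable points can be
padded with repetitions so that its steps alternate up and down, starting and ending
with an upward step.) -/
structure PInterval (P : Type v) [Preorder P] where
  carrier : Set P
  nonempty : carrier.Nonempty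
  ordConnected : carrier.OrdConnected
  zigzag : ∀ p ∈ carrier, ∀ q ∈ carrier,
    Relation.ReflTransGen (fun a b => a ∈ carrier ∧ b ∈ carrier ∧ (a ≤ b ∨ b ≤ a)) p q

section General

variable {P : Type v} [Preorder P]

open Classical in
/-- The value at `p` of the interval module of `I`: the space `k` if `p` is in `I`, and the zero
space otherwise. -/
def fiber (k : Type u) [Field k] (I : PInterval P) (p : P) : Submodule k k :=
  if p ∈ I.carrier then ⊤ else ⊥

theorem fiber_of_mem {k : Type u} [Field k] {I : PInterval P} {p : P} (hp : p ∈ I.carrier) :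
    fiber k I p = ⊤ := if_pos hp

theorem fiber_of_notMem {k : Type u} [Field k] {I : PInterval P} {p : P} (hp : p ∉ I.carrier) :
    fiber k I p = ⊥ := if_neg hp

theorem fiber_eq_zero {k : Type u} [Field k] {I : PInterval P} {p : P} (hp : p ∉ I.carrier)
    (x : fiber k I p) : (x : k) = 0 :=
  (Submodule.mem_bot k).1 ((fiber_of_notMem (k := k) hp) ▸ x.2)

open Classical in
/-- The map from the value at `p` to the value at `q` which is the identity of `k` if `q` is in
`I` and `p` is in `I`, and zero otherwise. -/
def fiberMap (k : Type u) [Field k] (I : PInterval P) (p q : P) :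
    fiber k I p →ₗ[k] fiber k I q where
  toFun x := ⟨if q ∈ I.carrier then (x : k) else 0, by
    by_cases h : q ∈ I.carrier
    · rw [fiber_of_mem h]
      exact Submodule.mem_top
    · rw [if_neg h]
      exact Submodule.zero_mem _⟩
  map_add' x y := by
    ext
    by_cases h : q ∈ I.carrier <;> simp [h]
  map_smul' c x := by
    ext
    by_cases h : q ∈ I.carrier <;> simp [h]

/-- The interval module of `I`. -/
def intervalModule (k : Type u) [Field k] (I : PInterval P) : PModule k P where
  obj p := ModuleCat.of k (fiber k I p)
  map {p q} _ := ModuleCat.ofHom (fiberMap k I p q)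
  map_id p := by
    ext x
    by_cases h : p ∈ I.carrier
    · simp [fiberMap, h]
    · have hx := fiber_eq_zero h x
      simp [fiberMap, h, hx]
  map_comp {p q r} f g := by
    ext x
    by_cases hr : r ∈ I.carrier
    · by_cases hq : q ∈ I.carrier
      · simp [fiberMap, hr, hq]
      · have hp : p ∉ I.carrier := fun hp => hq (I.ordConnected.out hp hr ⟨leOfHom f, leOfHom g⟩)
        have hx := fiber_eq_zero hp x
        simp [fiberMap, hr, hq, hx]
    · simp [fiberMap, hr]

/-- The (pointwise) direct sum of a family of persistence modules. -/
def directSum {k : Type u} [Field k] {ι : Type u} (M : ι → PModule k P) : PModule k P where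
  obj p := ModuleCat.of k (⨁ i, (M i).obj p)
  map f := ModuleCat.ofHom (DirectSum.lmap fun i => ((M i).map f).hom)
  map_id p := by
    ext i x
    simp
  map_comp f g := by
    ext i x
    simp

/-- The multiset of intervals `B`, given as an indexed family (so that repeated intervals are
told apart by their indices), is the barcode of `M`. -/
def IsBarcode {k : Type u} [Field k] {ι : Type u} (B : ι → PInterval P) (M : PModule k P) : Prop :=
  Nonempty (M ≅ directSum fun i => intervalModule k (B i))

/-- `M` is interval decomposable. -/
def IntervalDecomposable {k : Type u} [Field k] (M : PModule k P) : Prop :=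
  ∃ (ι : Type u) (B : ι → PInterval P), IsBarcode B M

/-- The free interval `⟨p⟩` of all points `q ≥ p`. -/
def freeInterval (p : P) : PInterval P where
  carrier := Set.Ici p
  nonempty := ⟨p, le_refl p⟩
  ordConnected := Set.ordConnected_Ici
  zigzag _ ha _ hb :=
    (Relation.ReflTransGen.single ⟨ha, le_refl p, Or.inr ha⟩).tail ⟨le_refl p, hb, Or.inl hb⟩

/-- `M` is free: it is interval decomposable with a barcode that consists of free intervals. -/
def IsFree {k : Type u} [Field k] (M : PModule k P) : Prop :=
  ∃ (ι : Type u) (B : ι → PInterval P), IsBarcode B M ∧ ∀ i, ∃ p, B i = freeInterval p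

/-- The shift of a persistence module along a monotone self-map `F` of the poset: its value at
`p` is `M (F p)`. -/
abbrev pullback {k : Type u} [Field k] (F : P →o P) (M : PModule k P) : PModule k P :=
  F.monotone.functor ⋙ M

end General

/-- The poset `ℝⁿ`, with the coordinatewise order: `p ≤ q` if and only if `p i ≤ q i` for all `i`.
It is a type synonym of `Fin n → ℝ`, so that its category structure is the one of the poset. -/
def Rn (n : ℕ) : Type := Fin n → ℝ

instance (n : ℕ) : PartialOrder (Rn n) := inferInstanceAs (PartialOrder (Fin n → ℝ))

/-- The translation `p ↦ p + (ε, …, ε)` of `ℝⁿ`. -/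
def translateBy (n : ℕ) (ε : ℝ≥0) : (Rn n) →o (Rn n) where
  toFun p := fun i => p i + ε
  monotone' _ _ h i := add_le_add_left (h i) (ε : ℝ)

theorem le_translateBy {n : ℕ} (ε : ℝ≥0) (p : Rn n) : p ≤ translateBy n ε p :=
  fun i => le_add_of_nonneg_right (a := p i) ε.2

section Euclidean

variable {k : Type u} [Field k] {n : ℕ}

/-- The shifted module `M(ε)`, with `M(ε)_p = M_{p+ε}`. -/
abbrev shift (ε : ℝ≥0) (M : PModule k (Rn n)) : PModule k (Rn n) :=
  pullback (translateBy n ε) M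

/-- `M` and `N` are `ε`-interleaved: there are morphisms `f : M → N(ε)` and `g : N → M(ε)` such
that `g(ε) ∘ f` and `f(ε) ∘ g` are given at each `p` by the internal morphism from `p` to
`p + ε + ε = p + 2ε`. -/
def Interleaved (ε : ℝ≥0) (M N : PModule k (Rn n)) : Prop :=
  ∃ (f : M ⟶ shift ε N) (g : N ⟶ shift ε M),
    (∀ p, f.app p ≫ g.app (translateBy n ε p) =
      M.map (homOfLE ((le_translateBy ε p).trans (le_translateBy ε (translateBy n ε p))))) ∧
    (∀ p, g.app p ≫ f.app (translateBy n ε p) =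
      N.map (homOfLE ((le_translateBy ε p).trans (le_translateBy ε (translateBy n ε p)))))

/-- `M` is `δ`-trivial: all internal morphisms from `p` to `p + δ` vanish. -/
def IsTrivial (δ : ℝ≥0) (M : PModule k (Rn n)) : Prop :=
  ∀ p, M.map (homOfLE (le_translateBy δ p)) = 0

/-- The interleaving distance, with values in `[0, ∞]`. -/
def interleavingDist (M N : PModule k (Rn n)) : ℝ≥0∞ :=
  ⨅ (ε : ℝ≥0) (_ : Interleaved ε M N), (ε : ℝ≥0∞)

/-- The partial bijection `σ` between the multisets of intervals `A` and `B` is an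
`ε`-matching. -/
structure IsMatching (k : Type u) [Field k] (ε : ℝ≥0) {ι κ : Type u}
    (A : ι → PInterval (Rn n)) (B : κ → PInterval (Rn n)) (σ : ι ≃. κ) : Prop where
  left_unmatched : ∀ i, σ i = none → IsTrivial (2 * ε) (intervalModule k (A i))
  right_unmatched : ∀ j, σ.symm j = none → IsTrivial (2 * ε) (intervalModule k (B j))
  matched : ∀ i, ∀ j ∈ σ i, Interleaved ε (intervalModule k (A i)) (intervalModule k (B j))

/-- `M` and `N` are `ε`-matched: both are interval decomposable and there is an `ε`-matching
between their barcodes. Barcodes are unique up to reindexing; the definition does not rely on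
this and asks for a matching whichever barcodes of `M` and `N` are taken. -/
def Matched (ε : ℝ≥0) (M N : PModule k (Rn n)) : Prop :=
  IntervalDecomposable M ∧ IntervalDecomposable N ∧
    ∀ (ι κ : Type u) (A : ι → PInterval (Rn n)) (B : κ → PInterval (Rn n)),
      IsBarcode A M → IsBarcode B N → ∃ σ : ι ≃. κ, IsMatching k ε A B σ

/-- The bottleneck distance, with values in `[0, ∞]`. -/
def bottleneckDist (M N : PModule k (Rn n)) : ℝ≥0∞ :=
  ⨅ (ε : ℝ≥0) (_ : Matched ε M N), (ε : ℝ≥0∞)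

end Euclidean

end Persistence

end

/-! Transition maps of free modules are the identity on coefficients with respect to the generators,
so an `ε`-interleaving becomes a pair of mutually inverse matrices `F`, `G` between the generators
`p i` and `q j`. A nonzero entry from `p i` to `q j` forces `q j ≤ p i + ε`, and symmetrically for
`G`. Let `α` be the coordinate sum. If `F` has an entry `i → j`, `G` has an entry `j → i'` and `α i
≤ α i'`, then one of the two steps does not decrease the coordinate sum. A step whose coordinates
are at most `ε` and have nonnegative sum has all coordinates at least `-(n - 1) * ε`, so its ends
are `(n - 1) * ε`-close. Looking at an index of maximal `α` in a hypothetical kernel vector then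
yields Hall's condition for closeness (`mk_le_mk_of_leftInverse`). Degrees may be infinite, so
positions are rounded to a grid, where closeness is locally finite and a cardinal version of Hall's
theorem applies (`exists_injective_of_locallyFinite`). Injections both ways combine by
Schröder–Bernstein, and the grid width tends to zero. -/

namespace Persistence

/-! ### Hall's theorem with infinite multiplicities. -/

section Combinatorics

open Cardinal

theorem mk_biUnion_finite_le {A : Type v} {I : Type u} {c : Cardinal.{u}} (hc : ℵ₀ ≤ c)
    {s : Set A} (hs : s.Finite) (f : A → Set I) (h : ∀ a ∈ s, #(f a) ≤ c) :
    #(⋃ a ∈ s, f a : Set I) ≤ c := by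
  induction s, hs using Set.Finite.induction_on with
  | empty => simp
  | @insert a s _ _ ih =>
    rw [Set.biUnion_insert]
    exact (mk_union_le _ _).trans (add_le_of_le hc (h a (Set.mem_insert _ _))
      (ih fun b hb => h b (Set.mem_insert_of_mem _ hb)))

theorem mk_biUnion_finite_lt {A : Type v} {I : Type u} {c : Cardinal.{u}} (hc : ℵ₀ ≤ c)
    {s : Set A} (hs : s.Finite) (f : A → Set I) (h : ∀ a ∈ s, #(f a) < c) :
    #(⋃ a ∈ s, f a : Set I) < c := by
  induction s, hs using Set.Finite.induction_on with
  | empty => simpa using aleph0_pos.trans_le hc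
  | @insert a s _ _ ih =>
    rw [Set.biUnion_insert]
    exact (mk_union_le _ _).trans_lt (add_lt_of_lt hc (h a (Set.mem_insert _ _))
      (ih fun b hb => h b (Set.mem_insert_of_mem _ hb)))

/-- A version of Hall's marriage theorem for infinite degrees: the relation only depends on
positions `P i` and `Q j`, and it is locally finite on positions. -/
theorem exists_injective_of_locallyFinite {A B : Type v} {I J : Type u} (P : I → A) (Q : J → B)
    (r : A → B → Prop) (hr : ∀ a, {b | r a b}.Finite) (hr' : ∀ b, {a | r a b}.Finite)
    (h : ∀ S : Set I, #S ≤ #{j | ∃ i ∈ S, r (P i) (Q j)}) :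
    ∃ φ : I → J, Function.Injective φ ∧ ∀ i, r (P i) (Q (φ i)) := by
  classical
  rcases isEmpty_or_nonempty I with hI | ⟨⟨i₁⟩⟩
  · exact ⟨isEmptyElim, fun i => isEmptyElim i, fun i => isEmptyElim i⟩
  obtain ⟨j₁⟩ : Nonempty J := by
    by_contra hJ
    have := h {i₁}
    rw [not_nonempty_iff] at hJ
    simp at this
  have : Nonempty B := ⟨Q j₁⟩
  -- A big neighbour `b` can absorb the whole fibre over `a`; being infinite, it can do so for
  -- finitely many such `a` at once.
  let big : A → B → Prop := fun a b => r a b ∧ ℵ₀ ≤ #(Q ⁻¹' {b}) ∧ #(P ⁻¹' {a}) ≤ #(Q ⁻¹' {b})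
  have hunion : ∀ a, {j | ∃ i ∈ P ⁻¹' {a}, r (P i) (Q j)} ⊆ ⋃ b ∈ {b | r a b}, Q ⁻¹' {b} := by
    rintro a j ⟨i, rfl, hj⟩
    simpa using hj
  -- If the fibre over `a` were infinite, all its finitely many neighbouring fibres would be
  -- strictly smaller, and so would their union, against Hall's condition.
  have small_left : ∀ a, (¬ ∃ b, big a b) → #(P ⁻¹' {a}) < ℵ₀ := by
    intro a ha
    by_contra! hinf
    refine (mk_biUnion_finite_lt hinf (hr a) (fun b => Q ⁻¹' {b}) fun b hb => ?_).not_ge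
      ((h _).trans (mk_le_mk_of_subset (hunion a)))
    by_contra! hle
    exact ha ⟨b, hb, hinf.trans hle, hle⟩
  have small_right : ∀ a, (¬ ∃ b, big a b) → ∀ b, r a b → #(Q ⁻¹' {b}) < ℵ₀ := by
    intro a ha b hb
    by_contra! hinf
    exact ha ⟨b, hb, hinf, (small_left a ha).le.trans hinf⟩
  have finite_nbhd : ∀ a, (¬ ∃ b, big a b) → {j | r a (Q j)}.Finite := by
    intro a ha
    have : {j | r a (Q j)} = ⋃ b ∈ {b | r a b}, Q ⁻¹' {b} := by ext; simp
    rw [this]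
    exact (hr a).biUnion fun b hb => lt_aleph0_iff_set_finite.1 (small_right a ha b hb)
  -- Indices without a big neighbour have finite degree, so the classical Hall theorem matches them.
  obtain ⟨ψ, hψ, hψr⟩ : ∃ ψ : {i // ¬ ∃ b, big (P i) b} → J,
      Function.Injective ψ ∧ ∀ i, ψ i ∈ (finite_nbhd _ i.2).toFinset := by
    refine (Finset.all_card_le_biUnion_card_iff_exists_injective _).1 fun s => ?_
    have h1 := h (Subtype.val '' (s : Set {i // ¬ ∃ b, big (P i) b}))
    have h2 : {j | ∃ i ∈ Subtype.val '' (s : Set {i // ¬ ∃ b, big (P i) b}), r (P i) (Q j)} =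
        (s.biUnion fun i => (finite_nbhd _ i.2).toFinset : Finset J) := by
      ext j
      simp
    rw [h2, mk_image_eq Subtype.val_injective, mk_fintype, mk_fintype] at h1
    simpa using h1
  choose! β hβ using fun a (ha : ∃ b, big a b) => ha
  -- All indices assigned to the same big `b` embed together in its fibre. Values of `e` outside
  -- this set are arbitrary defaults.
  have emb : ∀ b, ∃ e : I → J, Set.InjOn e {i | (∃ b, big (P i) b) ∧ β (P i) = b} ∧
      ∀ i ∈ {i | (∃ b, big (P i) b) ∧ β (P i) = b}, Q (e i) = b := by
    intro b
    rcases Set.eq_empty_or_nonempty {i | (∃ b, big (P i) b) ∧ β (P i) = b} with hX | ⟨i₀, hi₀, hb₀⟩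
    · rw [hX]
      exact ⟨fun _ => j₁, by simp, by simp⟩
    · have hb := hβ _ hi₀
      rw [hb₀] at hb
      have hle : #{i | (∃ b, big (P i) b) ∧ β (P i) = b} ≤ #(Q ⁻¹' {b}) := by
        refine le_trans (mk_le_mk_of_subset ?_) (mk_biUnion_finite_le hb.2.1
          (s := {a | big a b}) ((hr' b).subset fun a ha => ha.1) (fun a => P ⁻¹' {a})
          fun a ha => ha.2.2)
        rintro i ⟨hi, rfl⟩
        simpa using hβ _ hi
      obtain ⟨e⟩ := (Cardinal.le_def _ _).1 hle
      refine ⟨fun i => if hi : (∃ b, big (P i) b) ∧ β (P i) = b then (e ⟨i, hi⟩).1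
        else (e ⟨i₀, hi₀, hb₀⟩).1, ?_, ?_⟩
      · intro i hi i' hi' heq
        simp only [Set.mem_ofPred_eq] at hi hi'
        simp only [dif_pos hi, dif_pos hi'] at heq
        simpa using e.injective (Subtype.ext heq)
      · intro i hi
        simp only [Set.mem_ofPred_eq] at hi
        simp only [dif_pos hi]
        exact (e ⟨i, hi⟩).2
  choose e he heQ using emb
  refine ⟨fun i => if hi : ∃ b, big (P i) b then e (β (P i)) i else ψ ⟨i, hi⟩, ?_, ?_⟩
  -- The two partial maps have disjoint images: `e` lands in infinite fibres of `Q`, `ψ` in finite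
  -- ones.
  · have key : ∀ i i' (hi : ∃ b, big (P i) b) (hi' : ¬ ∃ b, big (P i') b),
        e (β (P i)) i ≠ ψ ⟨i', hi'⟩ := by
      intro i i' hi hi' heq
      have h1 : r (P i') (Q (ψ ⟨i', hi'⟩)) := by simpa using hψr ⟨i', hi'⟩
      rw [← heq, heQ _ i ⟨hi, rfl⟩] at h1
      exact (small_right _ hi' _ h1).not_ge (hβ _ hi).2.1
    intro i i' heq
    by_cases hi : ∃ b, big (P i) b <;> by_cases hi' : ∃ b, big (P i') b
    · simp only [dif_pos hi, dif_pos hi'] at heq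
      have hb : β (P i) = β (P i') := by
        rw [← heQ _ i ⟨hi, rfl⟩, heq, heQ _ i' ⟨hi', rfl⟩]
      rw [hb] at heq
      exact he _ ⟨hi, hb⟩ ⟨hi', rfl⟩ heq
    · simp only [dif_pos hi, dif_neg hi'] at heq
      exact (key _ _ hi hi' heq).elim
    · simp only [dif_pos hi', dif_neg hi] at heq
      exact (key _ _ hi' hi heq.symm).elim
    · simp only [dif_neg hi', dif_neg hi] at heq
      simpa using hψ heq
  · intro i
    by_cases hi : ∃ b, big (P i) b
    · simp only [dif_pos hi, heQ _ i ⟨hi, rfl⟩]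
      exact (hβ _ hi).1
    · simp only [dif_neg hi]
      simpa using hψr ⟨i, hi⟩

end Combinatorics

/-! ### Hall's condition from an invertible matrix. -/

section Rank

open Cardinal

variable {k : Type v} [Field k] {I J : Type u}

theorem apply_eq_sum_single (L : (I →₀ k) →ₗ[k] (J →₀ k)) (x : I →₀ k) (j : J) :
    L x j = x.sum fun i c => c * L (Finsupp.single i 1) j := by
  conv_lhs => rw [← Finsupp.sum_single x, map_finsuppSum, Finsupp.sum_apply]
  refine Finsupp.sum_congr fun i _ => ?_
  rw [← smul_eq_mul, ← Finsupp.smul_apply, ← map_smul, Finsupp.smul_single, smul_eq_mul, mul_one]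

/-- If `F` has a left inverse `G` and every two-step path `i → j → i'` through nonzero
coefficients of `F` and `G` that does not decrease `α` has a step in `rel`, then the relation
`rel` satisfies Hall's condition. -/
theorem mk_le_mk_of_leftInverse {R : Type*} [LinearOrder R] (F : (I →₀ k) →ₗ[k] (J →₀ k))
    (G : (J →₀ k) →ₗ[k] (I →₀ k)) (hGF : ∀ x, G (F x) = x) (rel : I → J → Prop) (α : I → R)
    (hrel : ∀ i j i', α i ≤ α i' → F (Finsupp.single i 1) j ≠ 0 →
      G (Finsupp.single j 1) i' ≠ 0 → rel i j ∨ rel i' j) (S : Set I) :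
    #S ≤ #{j | ∃ i ∈ S, rel i j} := by
  classical
  let N : Set J := {j | ∃ i ∈ S, rel i j}
  -- The block of `F` with columns in `S` and rows in `N`; its injectivity bounds `#S` by rank.
  let F' : (S →₀ k) →ₗ[k] (N →₀ k) :=
    Finsupp.lcomapDomain Subtype.val Subtype.val_injective ∘ₗ F ∘ₗ
      Finsupp.lmapDomain k k Subtype.val
  have hF' : Function.Injective F' := by
    rw [← LinearMap.ker_eq_bot, LinearMap.ker_eq_bot']
    intro x hx
    by_contra hne
    obtain ⟨i', hi', hmax⟩ := x.support.exists_max_image (fun i => α i)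
      (Finsupp.support_nonempty_iff.2 hne)
    let y : I →₀ k := Finsupp.mapDomain Subtype.val x
    have hyN : ∀ j ∈ N, F y j = 0 := fun j hj => DFunLike.congr_fun hx ⟨j, hj⟩
    have hFy : ∀ j, F y j = x.sum fun i c => c * F (Finsupp.single i.1 1) j := by
      intro j
      rw [apply_eq_sum_single, Finsupp.sum_mapDomain_index (by simp) (by simp [add_mul])]
    have hy : y i' = x i' := Finsupp.mapDomain_apply Subtype.val_injective _ _
    refine (Finsupp.mem_support_iff.1 hi') ?_
    rw [← hy, ← hGF y, apply_eq_sum_single]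
    refine Finset.sum_eq_zero fun j _ => ?_
    by_cases hj : j ∈ N
    · simp [hyN j hj]
    by_cases hg : G (Finsupp.single j 1) (i' : I) = 0
    · simp [hg]
    -- For `j` outside `N`, maximality of `α i'` lets `hrel` apply to every path `i → j → i'`;
    -- either outcome would put `j` in `N`.
    suffices h0 : F y j = 0 by simp [h0]
    rw [hFy]
    refine Finset.sum_eq_zero fun i hi => ?_
    by_contra hc
    rcases hrel i j i' (hmax i hi) (right_ne_zero_of_mul hc) hg with h | h
    exacts [hj ⟨i, i.2, h⟩, hj ⟨i', i'.2, h⟩]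
  have := LinearMap.rank_le_of_injective F' hF'
  simpa [N] using this

end Rank

end Persistence
namespace Persistence

/-! ### Coefficients, and free summands of free modules. -/

section Coefficients

variable {k : Type u} [Field k] {P : Type v} [Preorder P] {ι κ : Type u}

/-- The coefficients of an element of a sum of interval modules. -/
noncomputable def coeff (A : ι → PInterval P) (p : P) :
    (directSum fun i => intervalModule k (A i)).obj p →ₗ[k] (ι →₀ k) := by
  classical
  exact DirectSum.toModule k ι (ι →₀ k) fun i => Finsupp.lsingle i ∘ₗ (fiber k (A i) p).subtype

/-- The element of a sum of interval modules at `p` with a given component. -/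
noncomputable def component (A : ι → PInterval P) (p : P) (i : ι) :
    fiber k (A i) p →ₗ[k] (directSum fun i => intervalModule k (A i)).obj p := by
  classical
  exact DirectSum.lof k ι (fun i => (intervalModule k (A i)).obj p) i

theorem coeff_component (A : ι → PInterval P) (p : P) (i : ι) (c : fiber k (A i) p) :
    coeff A p (component A p i c) = Finsupp.single i (c : k) := by
  classical
  exact DirectSum.toModule_lof (M := fun i => fiber k (A i) p) k i c

theorem induction_component {A : ι → PInterval P} {p : P}
    {C : (directSum fun i => intervalModule k (A i)).obj p → Prop}
    (x : (directSum fun i => intervalModule k (A i)).obj p)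
    (h0 : C 0) (hadd : ∀ x y, C x → C y → C (x + y)) (hc : ∀ i c, C (component A p i c)) :
    C x := by
  classical
  exact DirectSum.induction_on (motive := C) x h0 hc hadd

theorem coeff_apply (A : ι → PInterval P) (p : P)
    (x : (directSum fun i => intervalModule k (A i)).obj p) (i : ι) :
    coeff A p x i = ((show ⨁ i, fiber k (A i) p from x) i : k) := by
  classical
  induction x using induction_component with
  | h0 => simp; rfl
  | hadd x y hx hy => rw [map_add, Finsupp.add_apply, hx, hy]; rfl
  | hc j c =>
    rw [coeff_component]
    change _ = ((DirectSum.lof k ι (fun i => fiber k (A i) p) j c) i : k)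
    by_cases h : j = i
    · subst h
      simp [DirectSum.lof_apply]
    · rw [Finsupp.single_eq_of_ne (Ne.symm h), DirectSum.lof_eq_of,
      DirectSum.of_eq_of_ne _ _ _ (Ne.symm h)]
      rfl

theorem coeff_injective (A : ι → PInterval P) (p : P) :
    Function.Injective (coeff (k := k) A p) := by
  intro x y h
  refine DFinsupp.ext fun i => Subtype.ext ?_
  have := DFunLike.congr_fun h i
  rwa [coeff_apply, coeff_apply] at this

theorem coeff_eq_zero {A : ι → PInterval P} {p : P}
    (x : (directSum fun i => intervalModule k (A i)).obj p) {i : ι} (hi : p ∉ (A i).carrier) :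
    coeff A p x i = 0 := by
  rw [coeff_apply]
  exact fiber_eq_zero hi _

theorem map_component (A : ι → PInterval P) {p q : P} (h : p ⟶ q) (i : ι)
    (c : fiber k (A i) p) :
    (directSum fun i => intervalModule k (A i)).map h (component A p i c) =
      component A q i (fiberMap k (A i) p q c) := by
  classical
  exact DirectSum.lmap_lof (fun i => ((intervalModule k (A i)).map h).hom) i c

/-- In an upper set a basis vector, once born, never dies, so transition maps leave coefficients
unchanged. -/
theorem coeff_map {A : ι → PInterval P} (hA : ∀ i, IsUpperSet (A i).carrier) {p q : P}
    (h : p ⟶ q) (x : (directSum fun i => intervalModule k (A i)).obj p) :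
    coeff A q ((directSum fun i => intervalModule k (A i)).map h x) = coeff A p x := by
  induction x using induction_component with
  | h0 => simp
  | hadd x y hx hy => rw [map_add, map_add, map_add, hx, hy]
  | hc i c =>
    rw [map_component, coeff_component, coeff_component]
    by_cases hp : p ∈ (A i).carrier
    · simp [fiberMap, hA i (leOfHom h) hp]
    · simp [fiberMap, fiber_eq_zero hp c]

theorem PInterval.ext_carrier {I J : PInterval P} (h : I.carrier = J.carrier) : I = J := by
  cases I
  cases J
  congr

theorem mem_freeInterval (p : P) : p ∈ (freeInterval p).carrier := le_refl p

/-- The generator of a free interval module. -/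
noncomputable def gen {I : PInterval P} {p : P} (hp : p ∈ I.carrier) : fiber k I p :=
  ⟨1, by rw [fiber_of_mem hp]; trivial⟩

theorem fiberMap_gen {I : PInterval P} {p q : P} (hp : p ∈ I.carrier) (hq : q ∈ I.carrier) :
    fiberMap k I p q (gen hp) = gen hq := by
  simp [fiberMap, gen, hq]

theorem eq_smul_gen {I : PInterval P} {p : P} (hp : p ∈ I.carrier) (c : fiber k I p) :
    c = (c : k) • gen hp := by
  ext
  simp [gen]

open Classical in
theorem apply_eq_linearCombination {V : Type*} [AddCommGroup V] [Module k V]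
    (A : ι → PInterval P) (p : P)
    (L : (directSum fun i => intervalModule k (A i)).obj p →ₗ[k] V)
    (x : (directSum fun i => intervalModule k (A i)).obj p) :
    L x = Finsupp.linearCombination k
      (fun i => if h : p ∈ (A i).carrier then L (component A p i (gen h)) else 0)
      (coeff A p x) := by
  induction x using induction_component with
  | h0 => simp
  | hadd x y hx hy => rw [map_add, map_add, map_add, hx, hy]
  | hc i c =>
    rw [coeff_component, Finsupp.linearCombination_single]
    by_cases hp : p ∈ (A i).carrier
    · rw [dif_pos hp, ← map_smul, ← map_smul, ← eq_smul_gen]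
    · have h0 : c = 0 := Subtype.ext (fiber_eq_zero hp c)
      simp [h0]

/-- An interval module that is a summand of a free module is free. -/
theorem eq_freeInterval_of_retract {I : PInterval P} (p : κ → P)
    (s : intervalModule k I ⟶ directSum fun j => intervalModule k (freeInterval (p j)))
    (t : (directSum fun j => intervalModule k (freeInterval (p j))) ⟶ intervalModule k I)
    (hst : s ≫ t = 𝟙 _) : ∃ x, I = freeInterval x := by
  have hup : ∀ j, IsUpperSet (freeInterval (p j)).carrier := fun j => isUpperSet_Ici _
  have hts : ∀ x y, t.app x (s.app x y) = y := fun x y => by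
    have := ConcreteCategory.congr_hom (congr_app hst x) y
    simpa using this
  have hs : ∀ {x y} (h : x ⟶ y) a, s.app y ((intervalModule k I).map h a) =
      (directSum fun j => intervalModule k (freeInterval (p j))).map h (s.app x a) :=
    fun h a => NatTrans.naturality_apply s h a
  have ht : ∀ {x y} (h : x ⟶ y) a,
      t.app y ((directSum fun j => intervalModule k (freeInterval (p j))).map h a) =
      (intervalModule k I).map h (t.app x a) := fun h a => NatTrans.naturality_apply t h a
  -- The coefficients of the embedded generator; by `hw` and the zigzags they do not depend on the
  -- point of `I`.
  let w : ∀ {x}, x ∈ I.carrier → (κ →₀ k) := fun {x} hx =>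
    coeff (fun j => freeInterval (p j)) x (s.app x (gen (k := k) hx))
  have hw : ∀ {x y} (hx : x ∈ I.carrier) (hy : y ∈ I.carrier), x ≤ y → w hx = w hy := by
    intro x y hx hy hxy
    have h1 := hs (homOfLE hxy) (gen (k := k) hx)
    change s.app y (fiberMap k I x y (gen hx)) = _ at h1
    rw [fiberMap_gen hx hy] at h1
    simp only [w]
    rw [h1, coeff_map hup]
  have hup' : IsUpperSet I.carrier := by
    intro x y hxy hx
    by_contra hy
    have h1 := hs (homOfLE hxy) (gen (k := k) hx)
    have h0 : (intervalModule k I).map (homOfLE hxy) (gen (k := k) hx) = 0 :=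
      Subtype.ext (fiber_eq_zero hy _)
    rw [h0, map_zero] at h1
    have h2 := congrArg (coeff (fun j => freeInterval (p j)) y) h1
    rw [coeff_map hup, map_zero] at h2
    have h3 : s.app x (gen (k := k) hx) = 0 := coeff_injective _ _ (by rw [← h2, map_zero])
    have h4 := hts x (gen (k := k) hx)
    rw [h3, map_zero] at h4
    have h5 := congrArg (Subtype.val : fiber k I x → k) h4
    simp [gen] at h5
    exact zero_ne_one h5
  obtain ⟨x, hx⟩ := I.nonempty
  -- A basis vector born outside `I` is killed by `t`, by naturality from its birth point. If all
  -- those in `w hx` were such, `t ∘ s` would vanish.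
  obtain ⟨j, hj, hjI⟩ : ∃ j, w hx j ≠ 0 ∧ p j ∈ I.carrier := by
    by_contra! hno
    have key : ∀ a : (directSum fun j => intervalModule k (freeInterval (p j))).obj x,
        (∀ j, coeff _ x a j ≠ 0 → p j ∉ I.carrier) → t.app x a = 0 := by
      intro a ha
      have h1 := apply_eq_linearCombination _ x (t.app x).hom a
      refine h1.trans (Finset.sum_eq_zero fun j hj => ?_)
      dsimp only
      split_ifs with hjx
      · have h2 := ht (homOfLE hjx) (component (fun j => freeInterval (p j)) (p j) j
          (gen (k := k) (mem_freeInterval (p j))))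
        rw [map_component, fiberMap_gen (mem_freeInterval (p j)) hjx] at h2
        have h3 : t.app (p j) (component (fun j => freeInterval (p j)) (p j) j
            (gen (k := k) (mem_freeInterval (p j)))) = 0 :=
          Subtype.ext (fiber_eq_zero (ha j (Finsupp.mem_support_iff.1 hj)) _)
        rw [h3, map_zero] at h2
        refine (congrArg _ h2).trans (smul_zero _)
      · exact smul_zero _
    have h4 := hts x (gen (k := k) hx)
    rw [key _ hno] at h4
    exact zero_ne_one (congrArg (Subtype.val : fiber k I x → k) h4)
  refine ⟨p j, PInterval.ext_carrier (Set.Subset.antisymm ?_ fun y hy => hup' hy hjI)⟩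
  intro z hz
  have hwz : w hx = w hz := by
    have := I.zigzag x hx z hz
    have h : ∃ hz : z ∈ I.carrier, w hx = w hz := by
      induction this with
      | refl => exact ⟨hx, rfl⟩
      | tail _ hbc ih =>
        obtain ⟨hb, hc, hle⟩ := hbc
        refine ⟨hc, (ih hb).2.trans ?_⟩
        rcases hle with h | h
        exacts [hw hb hc h, (hw hc hb h).symm]
    exact h.2
  -- The coefficient at `j` is nonzero at every `z` of `I`, which forces `p j ≤ z`.
  by_contra hzj
  rw [hwz] at hj
  exact hj (coeff_eq_zero _ hzj)

end Coefficients

end Persistence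
namespace Persistence

/-! ### Matrices of morphisms between free modules. -/

section Coefficients

variable {k : Type u} [Field k] {P : Type v} [Preorder P] {ι κ : Type u}

/-- A sum of free interval modules. -/
noncomputable abbrev freeSum (k : Type u) [Field k] (p : ι → P) : PModule k P :=
  directSum fun i => intervalModule k (freeInterval (p i))

/-- The linear map on coefficients given by a morphism of free modules. -/
noncomputable def coeffMap (Φ : P →o P) (p : ι → P) (q : κ → P)
    (h : freeSum k p ⟶ pullback Φ (freeSum k q)) : (ι →₀ k) →ₗ[k] (κ →₀ k) :=
  Finsupp.linearCombination k fun i => coeff (fun j => freeInterval (q j)) (Φ (p i))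
    (h.app (p i) (component (fun i => freeInterval (p i)) (p i) i (gen (mem_freeInterval (p i)))))

/-- By naturality, the matrix read off at the birth points describes the morphism at every point. -/
theorem coeff_app (Φ : P →o P) (p : ι → P) (q : κ → P)
    (h : freeSum k p ⟶ pullback Φ (freeSum k q)) (x : P) (a : (freeSum k p).obj x) :
    coeff (fun j => freeInterval (q j)) (Φ x) (h.app x a) =
      coeffMap Φ p q h (coeff (fun i => freeInterval (p i)) x a) := by
  have h1 := apply_eq_linearCombination _ x
    ((coeff (fun j => freeInterval (q j)) (Φ x)) ∘ₗ (h.app x).hom) a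
  refine h1.trans ?_
  rw [coeffMap, Finsupp.linearCombination_apply, Finsupp.linearCombination_apply]
  refine Finsupp.sum_congr fun i hi => ?_
  have hix : x ∈ (freeInterval (p i)).carrier := by
    by_contra hix
    exact (Finsupp.mem_support_iff.1 hi) (coeff_eq_zero a hix)
  rw [dif_pos hix]
  congr 1
  have h2 : h.app x ((freeSum k p).map (homOfLE hix)
      (component (fun i => freeInterval (p i)) (p i) i (gen (mem_freeInterval (p i))))) =
      (freeSum k q).map (Φ.monotone.functor.map (homOfLE hix)) (h.app (p i)
      (component (fun i => freeInterval (p i)) (p i) i (gen (mem_freeInterval (p i))))) :=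
    NatTrans.naturality_apply h _ _
  rw [map_component, fiberMap_gen (mem_freeInterval (p i)) hix] at h2
  refine (congrArg (coeff (fun j => freeInterval (q j)) (Φ x)) h2).trans ?_
  exact coeff_map (fun j => isUpperSet_Ici _) _ _

theorem le_of_coeffMap_single_ne_zero (Φ : P →o P) (p : ι → P) (q : κ → P)
    (h : freeSum k p ⟶ pullback Φ (freeSum k q)) {i : ι} {j : κ}
    (hij : coeffMap Φ p q h (Finsupp.single i 1) j ≠ 0) : q j ≤ Φ (p i) := by
  by_contra hle
  rw [coeffMap, Finsupp.linearCombination_single, one_smul] at hij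
  exact hij (coeff_eq_zero _ hle)

/-- The composite is a transition map, which is invisible on coefficients; this is what turns an
interleaving into an exact inverse pair. -/
theorem coeffMap_coeffMap (Φ Ψ : P →o P) (p : ι → P) (q : κ → P)
    (f : freeSum k p ⟶ pullback Φ (freeSum k q)) (g : freeSum k q ⟶ pullback Ψ (freeSum k p))
    (hle : ∀ x, x ≤ Ψ (Φ x))
    (hfg : ∀ x, f.app x ≫ g.app (Φ x) = (freeSum k p).map (homOfLE (hle x))) (a : ι →₀ k) :
    coeffMap Ψ q p g (coeffMap Φ p q f a) = a := by
  suffices h : coeffMap Ψ q p g ∘ₗ coeffMap Φ p q f = LinearMap.id from DFunLike.congr_fun h a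
  refine Finsupp.lhom_ext fun i c => ?_
  have hc := coeff_component (k := k) (fun i => freeInterval (p i)) (p i) i
    (c • gen (mem_freeInterval (p i)))
  have hc' : ((c • gen (mem_freeInterval (p i)) : fiber k (freeInterval (p i)) (p i)) : k) = c := by
    simp [gen]
  rw [hc'] at hc
  rw [← hc]
  refine (congrArg (coeffMap Ψ q p g) (coeff_app Φ p q f _ _).symm).trans ?_
  refine (coeff_app Ψ q p g _ _).symm.trans ?_
  refine (congrArg (coeff (fun i => freeInterval (p i)) _)
    (ConcreteCategory.congr_hom (hfg (p i)) _)).trans ?_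
  exact coeff_map (fun j => isUpperSet_Ici _) _ _

/-- Every barcode of a free module consists of free intervals. -/
theorem IsFree.eq_freeInterval {M : PModule k P} (hM : IsFree M) {A : ι → PInterval P}
    (hA : IsBarcode A M) (i : ι) : ∃ p, A i = freeInterval p := by
  classical
  obtain ⟨κ, B, ⟨eB⟩, hB⟩ := hM
  choose p hp using hB
  obtain rfl : B = fun j => freeInterval (p j) := funext hp
  obtain ⟨eA⟩ := hA
  let s : intervalModule k (A i) ⟶ directSum fun i => intervalModule k (A i) :=
    { app := fun x => ModuleCat.ofHom (component A x i)
      naturality := fun x y h => by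
        ext c
        exact (map_component A h i c).symm }
  let t : (directSum fun i => intervalModule k (A i)) ⟶ intervalModule k (A i) :=
    { app := fun x => ModuleCat.ofHom (DirectSum.component k ι (fun i => fiber k (A i) x) i)
      naturality := fun x y h => by
        ext c
        exact DirectSum.lmap_apply (fun i => ((intervalModule k (A i)).map h).hom) c i }
  refine eq_freeInterval_of_retract p (s ≫ eA.inv ≫ eB.hom) (eB.inv ≫ eA.hom ≫ t) ?_
  have : s ≫ t = 𝟙 _ := by
    ext x c
    exact DirectSum.component.lof_self (M := fun i => fiber k (A i) x) k i c
  simpa using this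

end Coefficients

/-! ### Interleavings of free interval modules. -/

section Euclidean

variable {k : Type u} [Field k] {n : ℕ}

theorem comp_conj {C : Type*} [Category* C] {X' X Y Y' Z Z' : C} (a : X' ⟶ X) (f : X ⟶ Y)
    (u : Y ⟶ Y') (v : Y' ⟶ Y) (g : Y ⟶ Z) (b : Z ⟶ Z') (huv : u ≫ v = 𝟙 Y) {h : X ⟶ Z}
    (hfg : f ≫ g = h) {h' : X' ⟶ Z'} (hh : a ≫ h ≫ b = h') :
    (a ≫ f ≫ u) ≫ (v ≫ g ≫ b) = h' := by
  simp only [Category.assoc]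
  rw [reassoc_of% huv, reassoc_of% hfg, hh]

theorem Interleaved.of_iso {ε : ℝ≥0} {M N M' N' : PModule k (Rn n)} (h : Interleaved ε M N)
    (e : M ≅ M') (e' : N ≅ N') : Interleaved ε M' N' := by
  obtain ⟨f, g, hfg, hgf⟩ := h
  exact ⟨e.inv ≫ f ≫ Functor.whiskerLeft _ e'.hom, e'.inv ≫ g ≫ Functor.whiskerLeft _ e.hom,
    fun p => comp_conj _ _ _ _ _ _ (e'.hom_inv_id_app _) (hfg p) (by simp),
    fun p => comp_conj _ _ _ _ _ _ (e.hom_inv_id_app _) (hgf p) (by simp)⟩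

/-- The morphism between interval modules that is the identity where possible. -/
noncomputable def freeIntervalHom (k : Type u) [Field k] {δ : ℝ≥0} {p q : Rn n}
    (h : q ≤ translateBy n δ p) :
    intervalModule k (freeInterval p) ⟶ shift δ (intervalModule k (freeInterval q)) where
  app x := ModuleCat.ofHom
    { toFun := fun c => (⟨(c : k), by
        by_cases hx : x ∈ (freeInterval p).carrier
        · rw [fiber_of_mem (show translateBy n δ x ∈ (freeInterval q).carrier from
            h.trans ((translateBy n δ).monotone hx))]
          trivial
        · rw [fiber_eq_zero hx c]
          exact zero_mem _⟩ : fiber k (freeInterval q) (translateBy n δ x))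
      map_add' := fun _ _ => rfl
      map_smul' := fun _ _ => rfl }
  naturality x y hxy := by
    ext c
    by_cases hx : x ∈ (freeInterval p).carrier
    · have hy : y ∈ (freeInterval p).carrier := le_trans hx (leOfHom hxy)
      have hy' : translateBy n δ y ∈ (freeInterval q).carrier :=
        h.trans ((translateBy n δ).monotone hy)
      refine Subtype.ext ?_
      exact (if_pos hy).trans (if_pos hy').symm
    · obtain rfl : c = 0 := Subtype.ext (fiber_eq_zero hx c)
      exact (map_zero _).trans (map_zero _).symm

theorem freeIntervalHom_comp {δ : ℝ≥0} {p q : Rn n}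
    (h : q ≤ translateBy n δ p) (h' : p ≤ translateBy n δ q) (x : Rn n) :
    (freeIntervalHom k h).app x ≫ (freeIntervalHom k h').app (translateBy n δ x) =
      (intervalModule k (freeInterval p)).map
        (homOfLE ((le_translateBy δ x).trans (le_translateBy δ (translateBy n δ x)))) := by
  ext c
  refine Subtype.ext ?_
  by_cases hx : x ∈ (freeInterval p).carrier
  · have hx' : translateBy n δ (translateBy n δ x) ∈ (freeInterval p).carrier :=
      le_trans hx ((le_translateBy δ x).trans (le_translateBy δ (translateBy n δ x)))
    exact (if_pos hx').symm
  · obtain rfl : c = 0 := Subtype.ext (fiber_eq_zero hx c)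
    exact congrArg Subtype.val ((map_zero _).trans (map_zero _).symm)

theorem interleaved_freeInterval {δ : ℝ≥0} {p q : Rn n}
    (h : q ≤ translateBy n δ p) (h' : p ≤ translateBy n δ q) :
    Interleaved δ (intervalModule k (freeInterval p)) (intervalModule k (freeInterval q)) :=
  ⟨freeIntervalHom k h, freeIntervalHom k h', freeIntervalHom_comp h h', freeIntervalHom_comp h' h⟩

end Euclidean

end Persistence
namespace Persistence

/-! ### From inverse matrices to bijections of generators. -/

section Grid

variable {k : Type v} [Field k] {I J : Type u} {n : ℕ}

/-- If the coordinates of `a` are at most `E` and their sum is nonnegative, then they are at least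
`-(n - 1) * E`. -/
theorem neg_le_of_sum_nonneg {a : Fin n → ℤ} {E : ℤ} (ha : ∀ c, a c ≤ E) (hs : 0 ≤ ∑ c, a c)
    (c : Fin n) : -((n - 1 : ℕ) * E) ≤ a c := by
  have h1 := Finset.add_sum_erase Finset.univ a (Finset.mem_univ c)
  have h2 := Finset.sum_le_card_nsmul (Finset.univ.erase c) a E fun x _ => ha x
  rw [Finset.card_erase_of_mem (Finset.mem_univ c), Finset.card_univ, Fintype.card_fin,
    nsmul_eq_mul] at h2
  linarith

/-- The upper bound `E` is within `(n - 1) * E` because `n ≥ 2`. -/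
theorem abs_le_of_sum_nonneg (hn : 2 ≤ n) {a : Fin n → ℤ} {E : ℤ} (hE : 0 ≤ E)
    (ha : ∀ c, a c ≤ E) (hs : 0 ≤ ∑ c, a c) (c : Fin n) : |a c| ≤ (n - 1 : ℕ) * E := by
  refine abs_le.2 ⟨neg_le_of_sum_nonneg ha hs c, (ha c).trans ?_⟩
  have : (1 : ℤ) ≤ (n - 1 : ℕ) := by omega
  nlinarith

theorem finite_abs_sub_le (a : Fin n → ℤ) (D : ℤ) :
    {b : Fin n → ℤ | ∀ c, |a c - b c| ≤ D}.Finite := by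
  refine (Set.finite_Icc (fun c => a c - D) (fun c => a c + D)).subset
    fun b hb => ⟨fun c => ?_, fun c => ?_⟩
  all_goals have := abs_le.1 (hb c); simp only; linarith

/-- An inverse pair of linear maps between `k^(I)` and `k^(J)` whose coefficients move the
positions upwards by at most `E` gives an injection that moves positions by at most
`(n - 1) * E`. -/
theorem exists_injective_of_inverse (hn : 2 ≤ n) (P : I → Fin n → ℤ) (Q : J → Fin n → ℤ) {E : ℤ}
    (hE : 0 ≤ E) (F : (I →₀ k) →ₗ[k] (J →₀ k)) (G : (J →₀ k) →ₗ[k] (I →₀ k))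
    (hGF : ∀ x, G (F x) = x)
    (hF : ∀ i j, F (Finsupp.single i 1) j ≠ 0 → ∀ c, Q j c ≤ P i c + E)
    (hG : ∀ i j, G (Finsupp.single j 1) i ≠ 0 → ∀ c, P i c ≤ Q j c + E) :
    ∃ φ : I → J, Function.Injective φ ∧ ∀ i c, |P i c - Q (φ i) c| ≤ (n - 1 : ℕ) * E := by
  refine exists_injective_of_locallyFinite P Q (fun a b => ∀ c, |a c - b c| ≤ (n - 1 : ℕ) * E)
    (fun a => finite_abs_sub_le a _) (fun b => ?_) fun S => ?_
  · simpa only [abs_sub_comm] using finite_abs_sub_le b ((n - 1 : ℕ) * E)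
  · refine mk_le_mk_of_leftInverse F G hGF _ (fun i => ∑ c, P i c) (fun i j i' hii' hf hg => ?_) S
    -- If the step `i → j` decreases the sum, then `j → i'` cannot, as `i'` has at least the sum of
    -- `i`.
    rcases le_total (∑ c, P i c) (∑ c, Q j c) with h | h
    · left
      intro c
      rw [abs_sub_comm]
      refine abs_le_of_sum_nonneg (a := fun c => Q j c - P i c) hn hE (fun c => ?_) ?_ c
      · have := hF i j hf c
        linarith
      · rw [Finset.sum_sub_distrib]
        linarith
    · right
      refine abs_le_of_sum_nonneg (a := fun c => P i' c - Q j c) hn hE (fun c => ?_) ?_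
      · have := hG i' j hg c
        linarith
      · rw [Finset.sum_sub_distrib]
        linarith

/-- The Schröder–Bernstein bijection uses only pairs from `φ` or `ψ`, so it keeps the distance
bound. -/
theorem exists_bijective_of_inverse (hn : 2 ≤ n) (P : I → Fin n → ℤ) (Q : J → Fin n → ℤ) {E : ℤ}
    (hE : 0 ≤ E) (F : (I →₀ k) →ₗ[k] (J →₀ k)) (G : (J →₀ k) →ₗ[k] (I →₀ k))
    (hGF : ∀ x, G (F x) = x) (hFG : ∀ y, F (G y) = y)
    (hF : ∀ i j, F (Finsupp.single i 1) j ≠ 0 → ∀ c, Q j c ≤ P i c + E)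
    (hG : ∀ i j, G (Finsupp.single j 1) i ≠ 0 → ∀ c, P i c ≤ Q j c + E) :
    ∃ φ : I → J, Function.Bijective φ ∧ ∀ i c, |P i c - Q (φ i) c| ≤ (n - 1 : ℕ) * E := by
  obtain ⟨φ, hφ, hφd⟩ := exists_injective_of_inverse hn P Q hE F G hGF hF hG
  obtain ⟨ψ, hψ, hψd⟩ := exists_injective_of_inverse hn Q P hE G F hFG
    (fun j i => hG i j) (fun j i => hF i j)
  exact Function.Embedding.schroeder_bernstein_of_rel hφ hψ
    (fun i j => ∀ c, |P i c - Q j c| ≤ (n - 1 : ℕ) * E) hφd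
    fun j c => by rw [abs_sub_comm]; exact hψd j c

/-- The version of `exists_bijective_of_inverse` for real positions, with an error `η`. -/
theorem exists_bijective_of_inverse_real (hn : 2 ≤ n) (p : I → Fin n → ℝ) (q : J → Fin n → ℝ)
    {ε η : ℝ} (hε : 0 ≤ ε) (hη : 0 < η) (F : (I →₀ k) →ₗ[k] (J →₀ k))
    (G : (J →₀ k) →ₗ[k] (I →₀ k)) (hGF : ∀ x, G (F x) = x) (hFG : ∀ y, F (G y) = y)
    (hF : ∀ i j, F (Finsupp.single i 1) j ≠ 0 → ∀ c, q j c ≤ p i c + ε)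
    (hG : ∀ i j, G (Finsupp.single j 1) i ≠ 0 → ∀ c, p i c ≤ q j c + ε) :
    ∃ φ : I → J, Function.Bijective φ ∧ ∀ i c, |p i c - q (φ i) c| ≤ (n - 1 : ℕ) * ε + η := by
  have hn0 : (0 : ℝ) < n := by exact_mod_cast (by omega : 0 < n)
  -- The ceiling of `ε / s` costs at most `n - 1` grid steps and the floors at most one more: `n * s
  -- = η` in total.
  let s : ℝ := η / n
  have hs : 0 < s := div_pos hη hn0
  have step : ∀ x y : ℝ, x ≤ y + ε → ⌊x / s⌋ ≤ ⌊y / s⌋ + ⌈ε / s⌉ := by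
    intro x y h
    rw [← Int.floor_add_intCast]
    refine Int.floor_le_floor ?_
    have h1 : x / s ≤ y / s + ε / s := by rw [← add_div]; gcongr
    linarith [Int.le_ceil (ε / s)]
  obtain ⟨φ, hφ, hd⟩ := exists_bijective_of_inverse hn (fun i c => ⌊p i c / s⌋)
    (fun j c => ⌊q j c / s⌋) (E := ⌈ε / s⌉) (Int.ceil_nonneg (by positivity)) F G hGF hFG
    (fun i j h c => step _ _ (hF i j h c)) (fun i j h c => step _ _ (hG i j h c))
  refine ⟨φ, hφ, fun i c => ?_⟩
  have h1 : |(⌊p i c / s⌋ : ℝ) - ⌊q (φ i) c / s⌋| ≤ (n - 1 : ℕ) * (⌈ε / s⌉ : ℝ) := by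
    exact_mod_cast hd i c
  have h2 : (n - 1 : ℕ) * (⌈ε / s⌉ : ℝ) ≤ (n - 1 : ℕ) * (ε / s + 1) := by
    gcongr
    exact (Int.ceil_lt_add_one _).le
  have h3 : |p i c / s - q (φ i) c / s| ≤ (n - 1 : ℕ) * (ε / s + 1) + 1 := by
    rw [abs_le] at h1 ⊢
    constructor <;> linarith [Int.floor_le (p i c / s), Int.floor_le (q (φ i) c / s),
      Int.lt_floor_add_one (p i c / s), Int.lt_floor_add_one (q (φ i) c / s)]
  rw [← sub_div, abs_div, abs_of_pos hs, div_le_iff₀ hs] at h3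
  refine h3.trans (le_of_eq ?_)
  have h4 : ((n - 1 : ℕ) : ℝ) = n - 1 := by
    rw [Nat.cast_sub (by omega), Nat.cast_one]
  have h5 : s * n = η := div_mul_cancel₀ _ hn0.ne'
  rw [h4, ← h5]
  field_simp
  ring

end Grid

/-- The matching is a full bijection, so no interval has to be trivial; `η` absorbs the rounding. -/
theorem Interleaved.matched {k : Type u} [Field k] {n : ℕ} (hn : 2 ≤ n) {M N : PModule k (Rn n)}
    (hM : IsFree M) (hN : IsFree N) {ε : ℝ≥0} (h : Interleaved ε M N) {η : ℝ≥0} (hη : 0 < η) :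
    Matched ((n - 1 : ℕ) * ε + η) M N := by
  obtain ⟨ι₀, A₀, hA₀, -⟩ := id hM
  obtain ⟨κ₀, B₀, hB₀, -⟩ := id hN
  refine ⟨⟨ι₀, A₀, hA₀⟩, ⟨κ₀, B₀, hB₀⟩, fun ι κ A B hA hB => ?_⟩
  choose p hp using hM.eq_freeInterval hA
  choose q hq using hN.eq_freeInterval hB
  obtain rfl : A = fun i => freeInterval (p i) := funext hp
  obtain rfl : B = fun j => freeInterval (q j) := funext hq
  obtain ⟨eA⟩ := hA
  obtain ⟨eB⟩ := hB
  obtain ⟨f, g, hfg, hgf⟩ := h.of_iso eA eB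
  obtain ⟨φ, hφ, hd⟩ := exists_bijective_of_inverse_real hn p q ε.2 (NNReal.coe_pos.2 hη)
    (coeffMap (translateBy n ε) p q f) (coeffMap (translateBy n ε) q p g)
    (coeffMap_coeffMap _ _ p q f g _ hfg) (coeffMap_coeffMap _ _ q p g f _ hgf)
    (fun i j h => le_of_coeffMap_single_ne_zero _ p q f h)
    (fun i j h => le_of_coeffMap_single_ne_zero _ q p g h)
  refine ⟨(Equiv.ofBijective φ hφ).toPEquiv, ⟨fun i hi => ?_, fun j hj => ?_, fun i j hij => ?_⟩⟩
  · simp [Equiv.toPEquiv_apply] at hi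
  · rw [← Equiv.toPEquiv_symm] at hj
    simp [Equiv.toPEquiv_apply] at hj
  · obtain rfl : φ i = j := by simpa [Equiv.toPEquiv_apply] using hij
    have hδ : (((n - 1 : ℕ) * ε + η : ℝ≥0) : ℝ) = (n - 1 : ℕ) * ε + η := by
      rw [NNReal.coe_add, NNReal.coe_mul, NNReal.coe_natCast]
    refine interleaved_freeInterval (fun c => ?_) (fun c => ?_)
    · have := (abs_le.1 (hd i c)).1
      change q (φ i) c ≤ p i c + (((n - 1 : ℕ) * ε + η : ℝ≥0) : ℝ)
      rw [hδ]
      simp only [NNReal.val_eq_coe] at this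
      linarith
    · have := (abs_le.1 (hd i c)).2
      change p i c ≤ q (φ i) c + (((n - 1 : ℕ) * ε + η : ℝ≥0) : ℝ)
      rw [hδ]
      simp only [NNReal.val_eq_coe] at this
      linarith

end Persistence

theorem corollary5p4 {k : Type*} [Field k] {n : ℕ} (hn : 2 ≤ n)
    (M N : Persistence.PModule k (Persistence.Rn n))
    (hM : Persistence.IsFree M) (hN : Persistence.IsFree N) :
    Persistence.bottleneckDist M N ≤
      ((n - 1 : ℕ) : ℝ≥0∞) * Persistence.interleavingDist M N := by
  -- A nonzero factor is needed to move the product inside the infimum, which is `⊤` when no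
  -- interleaving exists.
  have hn0 : ((n - 1 : ℕ) : ℝ≥0∞) ≠ 0 := by
    exact_mod_cast (by omega : n - 1 ≠ 0)
  have hn1 : ((n - 1 : ℕ) : ℝ≥0∞) ≠ ⊤ := ENNReal.natCast_ne_top _
  unfold Persistence.interleavingDist
  simp only [ENNReal.mul_iInf_of_ne hn0 hn1]
  refine le_iInf₂ fun ε hε => ENNReal.le_of_forall_pos_le_add fun η hη _ => ?_
  have hm := Persistence.Interleaved.matched hn hM hN hε hη
  have hle : Persistence.bottleneckDist M N ≤ (((n - 1 : ℕ) * ε + η : ℝ≥0) : ℝ≥0∞) :=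
    iInf₂_le_of_le _ hm le_rfl
  rwa [ENNReal.coe_add, ENNReal.coe_mul, ENNReal.coe_natCast] at hle
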